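/- **Setting.** Let $N,\chi,n\ge 1$ and $p\ge 0$ be integers, $x_0\in\mathbb R^N$, $r,\Lambda>0$, and $\mathcal B=\{x\in\mathbb R^N:\|x-x_0\|_\infty\le r\}$. For $\xi\in\mathbb R^N$ let $\Phi(\xi)\in\mathbb R^{(p+1)\times\cdots\times(p+1)}$ be the order-$N$ tensor $\Phi(\xi)[\alpha]=\prod_{i=1}^N \xi_i^{\alpha_i}/\alpha_i!$, $\alpha\in\{0,\dots,p\}^N$. A tensor $A$ of this shape has TT-rank at most $\chi$ if $A[\alpha]=G_1[\alpha_1]\cdots G_N[\alpha_N]$ for matrices $G_k[a]\in\mathbb R^{\rho_{k-1}\times \rho_k}$ with $\rho_0=\rho_N=1$ and $\rho_k\le\chi$ for $0<k<N$. Let $$\mathcal H=\Big\{x\mapsto \big\langle A,\Phi\big(\tfrac{x-x_0}{r}\big)\big\rangle \;:\; A \text{ of TT-rank at most } \chi,\ \|A\|_F\le\Lambda\Big\},\qquad K=\Big(\sum_{k\ge0}\frac1{(k!)^2}\Big)^{1/2}.$$ Let $(X_i,Y_i)_{i=1}^n$ be i.i.d., where $X_i\sim P_X$, $P_X$ is a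 probability distribution supported on $\mathcal B$, $Y_i=g(X_i)+\varepsilon_i$ with $g:\mathcal B\to\mathbb R$ measurable (for instance $C^{p+1}$), $\mathbb E[\varepsilon_i\mid X_i]=0$, $|g|\le G_{\max}$ on $\mathcal B$ and $|\varepsilon_i|\le\sigma$ almost surely. Put $Y_{\max}=G_{\max}+\sigma$ and $R(h)=\mathbb E_{X\sim P_X}[(h(X)-g(X))^2]$. An empirical risk minimizer (ERM) is any $\hat h\in\mathcal H$ that minimizes $\frac1n\sum_{i=1}^n(h(X_i)-Y_i)^2$ over $h\in\mathcal H$. Let $d$ be the pseudo-dimension of the loss class $\{(x,y)\mapsto(h(x)-y)^2: h\in\mathcal H\}$ on $\mathcal B\times[-Y_{\max},Y_{\max}]$, that is, the largest $k$ for which there are points $z_1,\dots,z_k$ and reals $t_1,\dots,t_k$ such that for every $S\subseteq\{1,\dots,k\}$ some $\ell$ in the class satisfies $\ell(z_i)>t_i\iff i\in S$ for all $i$. **Claim.** The pseudo-dimension $d$ is finite, and there is an absolute constant $C>0$ (independent of all the data above and of $\eta,\delta$) such that the following holds for all $\eta>0$ and $\delta\in(0,1)$. If $n\ge d$ and $$n\;\ge\;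 C\,\frac{(\Lambda K^N+Y_{\max})^4}{\eta^2}\left(d\log\frac{en}{d}+\log\frac2\delta\right),$$ then with probability at least $1-\delta$ every ERM $\hat h$ over $\mathcal H$ satisfies $$R(\hat h)\;\le\;\inf_{h\in\mathcal H}R(h)+\eta .$$ -/

import Mathlib

open MeasureTheory ProbabilityTheory

namespace LTTS

noncomputable section

/-- The patch `B(x₀, r) = {x : ‖x - x₀‖_∞ ≤ r}`; the norm of `Fin N → ℝ` is the sup norm. -/
def patch {N : ℕ} (x₀ : Fin N → ℝ) (r : ℝ) : Set (Fin N → ℝ) :=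
  {x | ‖x - x₀‖ ≤ r}

/-- Real tensors of order `N` with all mode sizes equal to `p + 1`. -/
abbrev Tensor (N p : ℕ) : Type := (Fin N → Fin (p + 1)) → ℝ

/-- Frobenius inner product. -/
def frobInner {N p : ℕ} (A B : Tensor N p) : ℝ := ∑ α, A α * B α

/-- Frobenius norm. -/
def frobNorm {N p : ℕ} (A : Tensor N p) : ℝ := Real.sqrt (∑ α, A α ^ 2)

/-- Factorial feature map `Φ(ξ)[α] = ∏ i, ξ_i ^ α_i / α_i !`. -/
def featureMap {N p : ℕ} (ξ : Fin N → ℝ) : Tensor N p :=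
  fun α => ∏ i, ξ i ^ (α i : ℕ) / (Nat.factorial (α i : ℕ) : ℝ)

/-- `K = √(I₀(2))`, where `I₀(2) = ∑ₖ 1 / (k!)²`. -/
def besselK : ℝ := Real.sqrt (∑' k : ℕ, 1 / (Nat.factorial k : ℝ) ^ 2)

/-- `A` has TT-rank at most `χ`: there are bond dimensions `ρ 0, …, ρ N` with `ρ 0 = ρ N = 1` and
`ρ k ≤ χ` for `0 < k < N`, and cores `G k a`, matrices of size `ρ k × ρ (k + 1)`, such that
`A[α]` is the (single) entry of the matrix product `G 0 (α 0) * ⋯ * G (N - 1) (α (N - 1))`.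
The matrix product is written out as the sum over all bond indices `s`. -/
def HasTTRankLE {N p : ℕ} (χ : ℕ) (A : Tensor N p) : Prop :=
  ∃ (ρ : Fin (N + 1) → ℕ)
    (G : (k : Fin N) → Fin (p + 1) → Matrix (Fin (ρ k.castSucc)) (Fin (ρ k.succ)) ℝ),
    ρ 0 = 1 ∧ ρ (Fin.last N) = 1 ∧
    (∀ k : Fin (N + 1), k ≠ 0 → k ≠ Fin.last N → ρ k ≤ χ) ∧
    ∀ α, A α = ∑ s : (k : Fin (N + 1)) → Fin (ρ k),
      ∏ k : Fin N, G k (α k) (s k.castSucc) (s k.succ)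

/-- The constrained tensor class `𝒜_TT(Λ, χ)`. -/
def ttTensors (N p χ : ℕ) (Λ : ℝ) : Set (Tensor N p) :=
  {A | HasTTRankLE χ A ∧ frobNorm A ≤ Λ}

/-- The predictor `h_A(x) = ⟨A, Φ((x - x₀) / r)⟩`. -/
def predictor {N p : ℕ} (x₀ : Fin N → ℝ) (r : ℝ) (A : Tensor N p) (x : Fin N → ℝ) : ℝ :=
  frobInner A (featureMap fun i => (x i - x₀ i) / r)

/-- The hypothesis class `ℋ_TT(Λ, χ)` of degree `p` on the patch `B(x₀, r)`. -/
def ttClass {N : ℕ} (p χ : ℕ) (x₀ : Fin N → ℝ) (r Λ : ℝ) : Set ((Fin N → ℝ) → ℝ) :=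
  predictor x₀ r '' ttTensors N p χ Λ

/-- The squared-loss class `{(x, y) ↦ (h x - y)² : h ∈ H}` on `B(x₀, r) × [-Ymax, Ymax]`,
the set in which the data take their values. -/
def lossClass {N : ℕ} (x₀ : Fin N → ℝ) (r Ymax : ℝ) (H : Set ((Fin N → ℝ) → ℝ)) :
    Set (patch x₀ r × Set.Icc (-Ymax) Ymax → ℝ) :=
  (fun h z => (h z.1 - z.2) ^ 2) '' H

/-- The points `z i` are pseudo-shattered by `F` with the thresholds `t i` as witnesses. -/
def PseudoShatters {Z : Type*} (F : Set (Z → ℝ)) {k : ℕ} (z : Fin k → Z) (t : Fin k → ℝ) : Prop :=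
  ∀ S : Set (Fin k), ∃ f ∈ F, ∀ i, t i < f (z i) ↔ i ∈ S

/-- Pseudo-dimension: the supremum of the sizes of pseudo-shattered families of points. -/
def pdim {Z : Type*} (F : Set (Z → ℝ)) : ℕ∞ :=
  ⨆ (k : ℕ) (_ : ∃ (z : Fin k → Z) (t : Fin k → ℝ), PseudoShatters F z t), (k : ℕ∞)

/-- The local regression model on the patch: `(X i, Y i)` are i.i.d. with `X i ∼ PX` supported on
the patch, `Y i = g (X i) + ε i`, `E[ε i | X i] = 0`, `|g| ≤ Gmax` on the patch, `|ε i| ≤ σ`.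
Only the values of `g` on the patch matter; there `g` is assumed to be measurable, which includes
every target that is continuous or `C^(p+1)` on the patch. -/
structure LocalRegressionModel {Ω : Type*} [MeasurableSpace Ω] (P : Measure Ω) {N n : ℕ}
    (x₀ : Fin N → ℝ) (r : ℝ) (PX : Measure (Fin N → ℝ)) (g : (Fin N → ℝ) → ℝ) (Gmax σ : ℝ)
    (X : Fin n → Ω → Fin N → ℝ) (Y ε : Fin n → Ω → ℝ) : Prop where
  measurable_g : Measurable fun x : patch x₀ r => g x
  measurable_X : ∀ i, Measurable (X i)
  measurable_Y : ∀ i, Measurable (Y i)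
  measurable_noise : ∀ i, Measurable (ε i)
  indep : iIndepFun (fun i ω => (X i ω, Y i ω)) P
  ident : ∀ i j, IdentDistrib (fun ω => (X i ω, Y i ω)) (fun ω => (X j ω, Y j ω)) P P
  law_X : ∀ i, P.map (X i) = PX
  supported : ∀ᵐ x ∂PX, x ∈ patch x₀ r
  label : ∀ i, ∀ᵐ ω ∂P, Y i ω = g (X i ω) + ε i ω
  unbiased : ∀ i, P[ε i | MeasurableSpace.comap (X i) inferInstance] =ᵐ[P] 0
  bounded_g : ∀ x ∈ patch x₀ r, |g x| ≤ Gmax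
  bounded_noise : ∀ i, ∀ᵐ ω ∂P, |ε i ω| ≤ σ

/-- Empirical risk `L̂ₙ(h) = (1/n) ∑ i, (h (x i) - y i)²`. -/
def empRisk {N n : ℕ} (x : Fin n → Fin N → ℝ) (y : Fin n → ℝ) (h : (Fin N → ℝ) → ℝ) : ℝ :=
  1 / (n : ℝ) * ∑ i, (h (x i) - y i) ^ 2

/-- `h` is an empirical risk minimizer over `H` for the sample `(x, y)`. -/
def IsERM {N n : ℕ} (H : Set ((Fin N → ℝ) → ℝ)) (x : Fin n → Fin N → ℝ) (y : Fin n → ℝ)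
    (h : (Fin N → ℝ) → ℝ) : Prop :=
  h ∈ H ∧ ∀ h' ∈ H, empRisk x y h ≤ empRisk x y h'

/-- Clean risk `R(h) = E[(h(X) - g(X))²]`, `X ∼ PX`. -/
def cleanRisk {N : ℕ} (PX : Measure (Fin N → ℝ)) (g h : (Fin N → ℝ) → ℝ) : ℝ :=
  ∫ x, (h x - g x) ^ 2 ∂PX

end

end LTTS

/-!
The excess risk bound follows from a uniform law of large numbers for the loss class: if the
empirical risk is within `η / 2` of the expected noisy risk for every predictor, then every
empirical risk minimizer is within `η` of the best noisy risk, and the noisy risk differs from the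
clean risk by the variance of the noise, because the noise is orthogonal to functions of `X`
(`LTTS.LocalRegressionModel.integral_loss_eq`, `LTTS.cleanRisk_le_iInf_add_of_isERM`).

The pseudo-dimension `d` is finite because the losses are quadratic polynomials in the coefficient
tensor and so lie in a finite-dimensional space of functions
(`LTTS.pdim_lossClass_ttClass_ne_top`). On the data the losses take values in `[0, B]` with
`B = (Λ K ^ N + Ymax) ^ 2`, by Cauchy–Schwarz and the factorization of the norm of the feature
tensor (`LTTS.abs_predictor_le`).

For a fixed level `t` the sets `{ℓ > t}`, `ℓ` in the loss class, have Vapnik–Chervonenkis dimension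
at most `d`, as shattering by them is pseudo-shattering with constant thresholds. The classical
Vapnik–Chervonenkis inequality (`LTTS.measure_sampleBad_le`: a ghost sample, random swaps,
Hoeffding's inequality for random signs, and the Sauer–Shelah lemma) therefore controls all of them
at once. The mean of `ℓ` is, up to the mesh, `B` times the average of the measures of `{ℓ > t}` over
a grid of levels `t` in `[0, B)`. About `4 B / η` levels are enough, and the union bound over them
(`LTTS.exists_uniform_deviation`) is affordable: the sample size condition forces the number of
levels to be at most `e n`, and `log (e n) ≤ d log (e n / d)` for `1 ≤ d ≤ n`
(`LTTS.exists_uniform_deviation_of_le`). For `d = 0` all losses coincide on the data and there is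
nothing to prove.

The events are measurable since continuity in the coefficient tensor reduces the class to a
countable dense subclass.
-/

namespace LTTS

/-! ### Sums of random signs -/

/-- The sign `±1` encoded by a Boolean. -/
def boolSign (b : Bool) : ℝ := if b then 1 else -1

lemma sum_exp_boolSign_le (a l : ℝ) (ha : |a| ≤ 1) :
    ∑ b : Bool, Real.exp (l * (boolSign b * a)) ≤ 2 * Real.exp (l ^ 2 / 2) := by
  have h : ∑ b : Bool, Real.exp (l * (boolSign b * a)) = 2 * Real.cosh (l * a) := by
    rw [Real.cosh_eq]
    simp [boolSign]
    ring
  rw [h]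
  have h2 : (l * a) ^ 2 ≤ l ^ 2 := by
    rw [mul_pow]
    exact mul_le_of_le_one_right (sq_nonneg l) ((sq_le_one_iff_abs_le_one a).2 ha)
  have h3 := Real.cosh_le_exp_half_sq (l * a)
  have h4 : Real.exp ((l * a) ^ 2 / 2) ≤ Real.exp (l ^ 2 / 2) := Real.exp_le_exp.2 (by linarith)
  linarith

lemma card_boolSign_sum_ge_le {ι : Type*} [Fintype ι] [DecidableEq ι] [Nonempty ι]
    (a : ι → ℝ) (ha : ∀ i, |a i| ≤ 1) {u : ℝ} (hu : 0 ≤ u) :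
    ((Finset.univ.filter fun s : ι → Bool => u ≤ ∑ i, boolSign (s i) * a i).card : ℝ)
      ≤ 2 ^ Fintype.card ι * Real.exp (-u ^ 2 / (2 * Fintype.card ι)) := by
  have hn : (0 : ℝ) < Fintype.card ι := by exact_mod_cast Fintype.card_pos
  -- the exponent that optimizes the Chernoff bound
  set l : ℝ := u / Fintype.card ι with hl
  have hl0 : 0 ≤ l := by positivity
  calc ((Finset.univ.filter fun s : ι → Bool => u ≤ ∑ i, boolSign (s i) * a i).card : ℝ)
      = ∑ s ∈ Finset.univ.filter fun s : ι → Bool => u ≤ ∑ i, boolSign (s i) * a i, (1 : ℝ) := by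
        simp
    _ ≤ ∑ s ∈ Finset.univ.filter fun s : ι → Bool => u ≤ ∑ i, boolSign (s i) * a i,
          Real.exp (l * ((∑ i, boolSign (s i) * a i) - u)) := by
        refine Finset.sum_le_sum fun s hs => Real.one_le_exp (mul_nonneg hl0 ?_)
        simpa using (Finset.mem_filter.1 hs).2
    _ ≤ ∑ s : ι → Bool, Real.exp (l * ((∑ i, boolSign (s i) * a i) - u)) :=
        Finset.sum_le_sum_of_subset_of_nonneg (Finset.filter_subset _ _)
          fun _ _ _ => (Real.exp_pos _).le
    _ = Real.exp (-(l * u)) * ∏ i, ∑ b : Bool, Real.exp (l * (boolSign b * a i)) := by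
        rw [Fintype.prod_sum, Finset.mul_sum]
        refine Finset.sum_congr rfl fun s _ => ?_
        rw [← Real.exp_sum, ← Real.exp_add, ← Finset.mul_sum]
        congr 1
        ring
    _ ≤ Real.exp (-(l * u)) * ∏ _i : ι, (2 * Real.exp (l ^ 2 / 2)) := by
        gcongr with i
        exact sum_exp_boolSign_le _ _ (ha i)
    _ = 2 ^ Fintype.card ι * Real.exp (-u ^ 2 / (2 * Fintype.card ι)) := by
        rw [Finset.prod_const, Finset.card_univ, mul_pow, ← Real.exp_nat_mul, mul_left_comm,
          ← Real.exp_add]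
        congr 2
        rw [hl]
        field_simp
        ring

/-- **Hoeffding's inequality** for a sum of random signs, in counting form. -/
lemma card_abs_boolSign_sum_ge_le {ι : Type*} [Fintype ι] [DecidableEq ι] [Nonempty ι]
    (a : ι → ℝ) (ha : ∀ i, |a i| ≤ 1) {u : ℝ} (hu : 0 ≤ u) :
    ((Finset.univ.filter fun s : ι → Bool => u ≤ |∑ i, boolSign (s i) * a i|).card : ℝ)
      ≤ 2 ^ Fintype.card ι * (2 * Real.exp (-u ^ 2 / (2 * Fintype.card ι))) := by
  have h1 := card_boolSign_sum_ge_le a ha hu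
  have h2 := card_boolSign_sum_ge_le (fun i => -a i) (by simpa using ha) hu
  have h3 : (Finset.univ.filter fun s : ι → Bool => u ≤ |∑ i, boolSign (s i) * a i|)
      ⊆ (Finset.univ.filter fun s : ι → Bool => u ≤ ∑ i, boolSign (s i) * a i) ∪
        (Finset.univ.filter fun s : ι → Bool => u ≤ ∑ i, boolSign (s i) * -a i) := by
    intro s
    simp [le_abs]
  have h4 := (Finset.card_le_card h3).trans (Finset.card_union_le _ _)
  have h5 := Nat.cast_le (α := ℝ).2 h4
  push_cast at h5
  linarith

/-! ### Growth of a set family of bounded Vapnik–Chervonenkis dimension -/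

/-- `S` shatters no more than `d` points of `G`: whenever the sets `S j` cut out all subsets of
`k` points of `G`, one has `k ≤ d`. -/
def VCDimLE {Z J : Type*} (S : J → Set Z) (G : Set Z) (d : ℕ) : Prop :=
  ∀ (k : ℕ) (z : Fin k → Z), (∀ i, z i ∈ G) →
    (∀ T : Set (Fin k), ∃ j, ∀ i, z i ∈ S j ↔ i ∈ T) → k ≤ d

open Classical in
/-- The subsets of the index set that the family `S` cuts out of the points `w`. -/
noncomputable def traces {Z J κ : Type*} [Fintype κ] (S : J → Set Z) (w : κ → Z) :
    Finset (Finset κ) :=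
  Finset.univ.filter fun T => ∃ j, ∀ i, i ∈ T ↔ w i ∈ S j

/-- The **Sauer–Shelah bound** for the number of traces. -/
lemma card_traces_le {Z J κ : Type*} [Fintype κ] {S : J → Set Z} {G : Set Z} {d : ℕ}
    (h : VCDimLE S G d) (w : κ → Z) (hw : ∀ i, w i ∈ G) :
    (traces S w).card ≤ ∑ k ∈ Finset.range (d + 1), (Fintype.card κ).choose k := by
  classical
  have hd : (traces S w).vcDim ≤ d := by
    refine Finset.sup_le fun T hT => ?_
    rw [Finset.mem_shatterer] at hT
    refine h T.card (fun i => w (T.equivFin.symm i)) (fun i => hw _) fun U => ?_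
    obtain ⟨V, hV, hVT⟩ := @hT (T.filter fun a => ∃ ha : a ∈ T, T.equivFin ⟨a, ha⟩ ∈ U)
      (Finset.filter_subset _ _)
    obtain ⟨j, hj⟩ := (Finset.mem_filter.1 hV).2
    refine ⟨j, fun i => ?_⟩
    rw [← hj]
    have h1 : ((T.equivFin.symm i : T) : κ) ∈ T := (T.equivFin.symm i).2
    have h2 := Finset.ext_iff.1 hVT (T.equivFin.symm i)
    simpa [h1] using h2
  refine (Finset.card_le_card_shatterer _).trans (Finset.card_shatterer_le_sum_vcDim.trans ?_)
  refine Finset.sum_le_sum_of_subset fun k hk => ?_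
  rw [Finset.mem_Iic] at hk
  exact Finset.mem_range.2 (by omega)

/-- The partial binomial sum in the Sauer–Shelah bound is at most `(e m / d) ^ d`, written so that
it also holds for `d = 0`. -/
lemma sum_choose_le_exp {m d : ℕ} (hdm : d ≤ m) :
    ((∑ k ∈ Finset.range (d + 1), m.choose k : ℕ) : ℝ)
      ≤ Real.exp (d * Real.log (Real.exp 1 * m / d)) := by
  rcases Nat.eq_zero_or_pos d with rfl | hd
  · simp
  have hd' : (0 : ℝ) < d := by exact_mod_cast hd
  have hm' : (0 : ℝ) < m := by exact_mod_cast hd.trans_le hdm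
  have hq1 : (d : ℝ) / m ≤ 1 := (div_le_one hm').2 (by exact_mod_cast hdm)
  have hq0 : (0 : ℝ) < (d : ℝ) / m := by positivity
  have key : ((∑ k ∈ Finset.range (d + 1), m.choose k : ℕ) : ℝ) * ((d : ℝ) / m) ^ d
      ≤ Real.exp d := by
    calc ((∑ k ∈ Finset.range (d + 1), m.choose k : ℕ) : ℝ) * ((d : ℝ) / m) ^ d
        = ∑ k ∈ Finset.range (d + 1), (m.choose k : ℝ) * ((d : ℝ) / m) ^ d := by
          push_cast
          rw [Finset.sum_mul]
      _ ≤ ∑ k ∈ Finset.range (d + 1), (m.choose k : ℝ) * ((d : ℝ) / m) ^ k := by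
          refine Finset.sum_le_sum fun k hk => ?_
          have : k ≤ d := by have := Finset.mem_range.1 hk; omega
          exact mul_le_mul_of_nonneg_left (pow_le_pow_of_le_one hq0.le hq1 this) (by positivity)
      _ ≤ ∑ k ∈ Finset.range (m + 1), (m.choose k : ℝ) * ((d : ℝ) / m) ^ k := by
          refine Finset.sum_le_sum_of_subset_of_nonneg ?_ fun _ _ _ => by positivity
          exact Finset.range_mono (by omega)
      _ = ((d : ℝ) / m + 1) ^ m := by
          rw [add_pow]
          refine Finset.sum_congr rfl fun k _ => ?_
          simp [mul_comm]
      _ ≤ Real.exp ((d : ℝ) / m) ^ m :=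
          pow_le_pow_left₀ (by positivity) (Real.add_one_le_exp _) _
      _ = Real.exp d := by
          rw [← Real.exp_nat_mul]
          congr 1
          field_simp
  have h2 : Real.exp (d * Real.log (Real.exp 1 * m / d)) * ((d : ℝ) / m) ^ d = Real.exp d := by
    rw [Real.exp_nat_mul, Real.exp_log (by positivity), ← mul_pow]
    have : Real.exp 1 * m / d * (d / m) = Real.exp 1 := by field_simp
    rw [this, ← Real.exp_nat_mul, mul_one]
  rw [← h2] at key
  exact le_of_mul_le_mul_right key (by positivity)

/-! ### Uniform deviations of empirical frequencies -/

/-- Exchange the two entries of the pairs `w i` with `s i = false`. -/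
def swapBy {ι Z : Type*} (s : ι → Bool) (w : ι → Z × Z) : ι → Z × Z :=
  fun i => if s i then w i else (w i).swap

lemma measurePreserving_swapBy {ι Z : Type*} [Fintype ι] [MeasurableSpace Z] (μ : Measure Z)
    [IsProbabilityMeasure μ] (s : ι → Bool) :
    MeasurePreserving (swapBy s) (Measure.pi fun _ : ι => μ.prod μ)
      (Measure.pi fun _ : ι => μ.prod μ) := by
  refine measurePreserving_pi (fun _ : ι => μ.prod μ) (fun _ : ι => μ.prod μ)
    (f := fun i z => if s i then z else z.swap) fun i => ?_
  cases s i
  · simpa using Measure.measurePreserving_swap (μ := μ) (ν := μ)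
  · exact MeasurePreserving.id (μ.prod μ)

/-- The number of the points `x i` that lie in `A`. -/
noncomputable def hits {ι Z : Type*} [Fintype ι] (A : Set Z) (x : ι → Z) : ℝ :=
  ∑ i, A.indicator (fun _ => (1 : ℝ)) (x i)

lemma measurable_hits {ι Z : Type*} [Fintype ι] [MeasurableSpace Z] {A : Set Z}
    (hA : MeasurableSet A) : Measurable (hits A : (ι → Z) → ℝ) := by
  unfold hits
  refine Finset.measurable_sum _ fun i _ => ?_
  exact (measurable_const.indicator hA).comp (measurable_pi_apply i)

/-- The pairs of samples in which some `S j` is hit at least `u` times more often by one half than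
by the other. -/
def ghostBad {ι Z J : Type*} [Fintype ι] (S : J → Set Z) (u : ℝ) : Set (ι → Z × Z) :=
  {w | ∃ j, u ≤ |hits (S j) (fun i => (w i).1) - hits (S j) (fun i => (w i).2)|}

lemma measurableSet_ghostBad {ι Z J : Type*} [Fintype ι] [MeasurableSpace Z] [Countable J]
    {S : J → Set Z} (hS : ∀ j, MeasurableSet (S j)) (u : ℝ) :
    MeasurableSet (ghostBad S u : Set (ι → Z × Z)) := by
  have : (ghostBad S u : Set (ι → Z × Z)) =
      ⋃ j, {w | u ≤ |hits (S j) (fun i => (w i).1) - hits (S j) (fun i => (w i).2)|} := by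
    ext; simp [ghostBad]
  rw [this]
  refine MeasurableSet.iUnion fun j => measurableSet_le measurable_const ?_
  have h1 : Measurable fun w : ι → Z × Z => hits (S j) (fun i => (w i).1) :=
    (measurable_hits (hS j)).comp (by fun_prop)
  have h2 : Measurable fun w : ι → Z × Z => hits (S j) (fun i => (w i).2) :=
    (measurable_hits (hS j)).comp (by fun_prop)
  exact continuous_abs.measurable.comp (h1.sub h2)

open Classical in
/-- For a fixed pair of samples only few choices of swaps make it bad: the difference of the hits
of `S j` is a sum of random signs that depends on `j` only through the trace of `S j`. -/
lemma card_swapBy_mem_ghostBad_le {ι Z J : Type*} [Fintype ι] [Nonempty ι] {S : J → Set Z}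
    {G : Set Z} {d : ℕ} (h : VCDimLE S G d) (w : ι → Z × Z)
    (hw : ∀ i, (w i).1 ∈ G ∧ (w i).2 ∈ G) {u : ℝ} (hu : 0 ≤ u) :
    ((Finset.univ.filter fun s : ι → Bool => swapBy s w ∈ ghostBad S u).card : ℝ) ≤
      2 ^ Fintype.card ι *
        ((∑ k ∈ Finset.range (d + 1), (2 * Fintype.card ι).choose k : ℕ) *
          (2 * Real.exp (-u ^ 2 / (2 * Fintype.card ι)))) := by
  set w' : ι × Bool → Z := fun q => if q.2 then (w q.1).1 else (w q.1).2 with hw'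
  let a : Finset (ι × Bool) → ι → ℝ := fun T i =>
    (if (i, true) ∈ T then 1 else 0) - (if (i, false) ∈ T then 1 else 0)
  have ha : ∀ T i, |a T i| ≤ 1 := by
    intro T i
    simp only [a]
    split_ifs <;> norm_num
  have hsub : (Finset.univ.filter fun s : ι → Bool => swapBy s w ∈ ghostBad S u) ⊆
      (traces S w').biUnion fun T =>
        Finset.univ.filter fun s : ι → Bool => u ≤ |∑ i, boolSign (s i) * a T i| := by
    intro s hs
    obtain ⟨j, hj⟩ := (Finset.mem_filter.1 hs).2
    refine Finset.mem_biUnion.2 ⟨Finset.univ.filter fun q => w' q ∈ S j, ?_, ?_⟩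
    · exact Finset.mem_filter.2 ⟨Finset.mem_univ _, j, by simp⟩
    · refine Finset.mem_filter.2 ⟨Finset.mem_univ _, hj.trans_eq ?_⟩
      unfold hits
      rw [← Finset.sum_sub_distrib]
      congr 1
      refine Finset.sum_congr rfl fun i _ => ?_
      cases hsi : s i <;> simp [swapBy, hsi, boolSign, a, hw', Set.indicator_apply]
  have hcard : (traces S w').card ≤
      ∑ k ∈ Finset.range (d + 1), (2 * Fintype.card ι).choose k := by
    have := card_traces_le h w' (by
      rintro ⟨i, b⟩
      cases b
      · exact (hw i).2
      · exact (hw i).1)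
    rwa [Fintype.card_prod, Fintype.card_bool, mul_comm] at this
  have hcard' : ((traces S w').card : ℝ) ≤
    (∑ k ∈ Finset.range (d + 1), (2 * Fintype.card ι).choose k : ℕ) := by exact_mod_cast hcard
  calc ((Finset.univ.filter fun s : ι → Bool => swapBy s w ∈ ghostBad S u).card : ℝ)
      ≤ ∑ T ∈ traces S w',
          ((Finset.univ.filter fun s : ι → Bool => u ≤ |∑ i, boolSign (s i) * a T i|).card : ℝ) := by
        exact_mod_cast (Finset.card_le_card hsub).trans Finset.card_biUnion_le
    _ ≤ ∑ T ∈ traces S w',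
          (2 ^ Fintype.card ι * (2 * Real.exp (-u ^ 2 / (2 * Fintype.card ι))) : ℝ) :=
        Finset.sum_le_sum fun T _ => card_abs_boolSign_sum_ge_le (a T) (ha T) hu
    _ = (traces S w').card *
          (2 ^ Fintype.card ι * (2 * Real.exp (-u ^ 2 / (2 * Fintype.card ι)))) := by
        rw [Finset.sum_const, nsmul_eq_mul]
    _ ≤ _ := by
        rw [mul_left_comm]
        gcongr

open Classical in
/-- The probability of a large discrepancy between two independent samples: averaging over all
swaps leaves the law of the pair invariant. -/
lemma measure_ghostBad_le {ι Z J : Type*} [Fintype ι] [Nonempty ι] [MeasurableSpace Z]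
    [Countable J] (μ : Measure Z) [IsProbabilityMeasure μ] {S : J → Set Z} {G : Set Z} {d : ℕ}
    (hS : ∀ j, MeasurableSet (S j)) (hG : ∀ᵐ z ∂μ, z ∈ G) (h : VCDimLE S G d)
    {u : ℝ} (hu : 0 ≤ u) :
    (Measure.pi fun _ : ι => μ.prod μ) (ghostBad S u) ≤
      ENNReal.ofReal ((∑ k ∈ Finset.range (d + 1), (2 * Fintype.card ι).choose k : ℕ) *
          (2 * Real.exp (-u ^ 2 / (2 * Fintype.card ι)))) := by
  set ν := Measure.pi fun _ : ι => μ.prod μ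
  set b : ℝ := (∑ k ∈ Finset.range (d + 1), (2 * Fintype.card ι).choose k : ℕ) *
          (2 * Real.exp (-u ^ 2 / (2 * Fintype.card ι)))
  have hmeas := measurableSet_ghostBad (ι := ι) hS u
  have hgood : ∀ᵐ w ∂ν, ∀ i, (w i).1 ∈ G ∧ (w i).2 ∈ G := by
    have h1 : ∀ᵐ z ∂(μ.prod μ), z.1 ∈ G ∧ z.2 ∈ G := by
      have h2 := Measure.quasiMeasurePreserving_fst (μ := μ) (ν := μ) |>.ae hG
      have h3 := Measure.quasiMeasurePreserving_snd (μ := μ) (ν := μ) |>.ae hG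
      filter_upwards [h2, h3] with z h2 h3 using ⟨h2, h3⟩
    rw [ae_all_iff]
    intro i
    exact (measurePreserving_eval (fun _ : ι => μ.prod μ) i).quasiMeasurePreserving.ae h1
  have hmain : (2 : ENNReal) ^ Fintype.card ι * ν (ghostBad S u) ≤
      2 ^ Fintype.card ι * ENNReal.ofReal b := by
    calc (2 : ENNReal) ^ Fintype.card ι * ν (ghostBad S u)
        = ∑ s : ι → Bool, ν (swapBy s ⁻¹' ghostBad S u) := by
          have : ∀ s : ι → Bool, ν (swapBy s ⁻¹' ghostBad S u) = ν (ghostBad S u) := fun s =>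
            (measurePreserving_swapBy μ s).measure_preimage hmeas.nullMeasurableSet
          simp [this]
      _ = ∑ s : ι → Bool, ∫⁻ w, (swapBy s ⁻¹' ghostBad S u).indicator (fun _ => (1 : ENNReal)) w
          ∂ν := by
          refine Finset.sum_congr rfl fun s _ => ?_
          rw [lintegral_indicator_const ((measurePreserving_swapBy μ s).measurable hmeas), one_mul]
      _ = ∫⁻ w, ∑ s : ι → Bool, (swapBy s ⁻¹' ghostBad S u).indicator (fun _ => (1 : ENNReal)) w
          ∂ν := by
          rw [lintegral_finsetSum]
          exact fun s _ =>
            measurable_const.indicator ((measurePreserving_swapBy μ s).measurable hmeas)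
      _ ≤ ∫⁻ w, 2 ^ Fintype.card ι * ENNReal.ofReal b ∂ν := by
          refine lintegral_mono_ae ?_
          filter_upwards [hgood] with w hw
          have h1 := card_swapBy_mem_ghostBad_le h w hw hu
          have h2 : ∑ s : ι → Bool, (swapBy s ⁻¹' ghostBad S u).indicator (fun _ => (1 : ENNReal)) w =
              ENNReal.ofReal
                (Finset.univ.filter fun s : ι → Bool => swapBy s w ∈ ghostBad S u).card := by
            simp [Set.indicator_apply, Finset.sum_boole]
          rw [h2]
          refine (ENNReal.ofReal_le_ofReal h1).trans_eq ?_
          rw [ENNReal.ofReal_mul (by positivity), ENNReal.ofReal_pow (by norm_num)]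
          simp [b]
      _ = 2 ^ Fintype.card ι * ENNReal.ofReal b := by simp
  exact (ENNReal.mul_le_mul_iff_right (by simp) (by simp)).1 hmain

/-- The samples in which the number of hits of some `S j` deviates from its mean by `v` or more. -/
def sampleBad {ι Z J : Type*} [Fintype ι] [MeasurableSpace Z] (μ : Measure Z) (S : J → Set Z)
    (v : ℝ) : Set (ι → Z) :=
  {x | ∃ j, v ≤ |hits (S j) x - Fintype.card ι * μ.real (S j)|}

lemma measurableSet_sampleBad {ι Z J : Type*} [Fintype ι] [MeasurableSpace Z] [Countable J]
    (μ : Measure Z) {S : J → Set Z} (hS : ∀ j, MeasurableSet (S j)) (v : ℝ) :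
    MeasurableSet (sampleBad μ S v : Set (ι → Z)) := by
  have : (sampleBad μ S v : Set (ι → Z)) =
      ⋃ j, {x | v ≤ |hits (S j) x - Fintype.card ι * μ.real (S j)|} := by
    ext; simp [sampleBad]
  rw [this]
  refine MeasurableSet.iUnion fun j => measurableSet_le measurable_const ?_
  exact continuous_abs.measurable.comp ((measurable_hits (hS j)).sub_const _)

/-- Chebyshev's inequality for the number of hits, for deviations `u` of at least the order of the
standard deviation. -/
lemma measure_hits_dev_le_half {ι Z : Type*} [Fintype ι] [MeasurableSpace Z]
    (μ : Measure Z) [IsProbabilityMeasure μ] {A : Set Z} (hA : MeasurableSet A) {u : ℝ}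
    (hu : 0 < u) (hun : Fintype.card ι ≤ 2 * u ^ 2) :
    (Measure.pi fun _ : ι => μ) {x | u ≤ |hits A x - Fintype.card ι * μ.real A|} ≤ 1 / 2 := by
  have hind : Measurable (A.indicator fun _ => (1 : ℝ)) := measurable_const.indicator hA
  have hmem : MemLp (A.indicator fun _ => (1 : ℝ)) 2 μ :=
    memLp_indicator_const 2 hA 1 (Or.inr (measure_ne_top _ _))
  have hh : (∑ i : ι, fun x : ι → Z => A.indicator (fun _ => (1 : ℝ)) (x i)) = hits A := by
    ext x; simp [hits]
  have hvar : Var[hits A; Measure.pi fun _ : ι => μ] ≤ Fintype.card ι * (1 / 4) := by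
    rw [← hh, variance_sum_pi fun _ => hmem, Finset.sum_const, Finset.card_univ, nsmul_eq_mul]
    gcongr
    refine (variance_le_sq_of_bounded (a := 0) (b := 1) (Filter.Eventually.of_forall fun z => ?_)
      hind.aemeasurable).trans (by norm_num)
    by_cases hz : z ∈ A <;> simp [hz]
  have hmemi : ∀ i : ι, MemLp (fun x : ι → Z => A.indicator (fun _ => (1 : ℝ)) (x i)) 2
      (Measure.pi fun _ : ι => μ) := fun i =>
    hmem.comp_measurePreserving (measurePreserving_eval (fun _ : ι => μ) i)
  have hmemh : MemLp (hits A) 2 (Measure.pi fun _ : ι => μ) := by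
    rw [← hh]
    exact memLp_finsetSum' _ fun i _ => hmemi i
  have hint : ∫ x, hits A x ∂(Measure.pi fun _ : ι => μ) = Fintype.card ι * μ.real A := by
    unfold hits
    rw [integral_finsetSum _ fun i _ => (hmemi i).integrable (by norm_num)]
    have : ∀ i : ι, ∫ x : ι → Z, A.indicator (fun _ => (1 : ℝ)) (x i) ∂(Measure.pi fun _ : ι => μ)
        = μ.real A := by
      intro i
      rw [integral_comp_eval (μ := fun _ : ι => μ) hind.aestronglyMeasurable]
      simp [integral_indicator_const _ hA]
    simp [this]
  have := meas_ge_le_variance_div_sq hmemh hu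
  rw [hint] at this
  refine this.trans ?_
  have h12 : (1 / 2 : ENNReal) = ENNReal.ofReal (1 / 2) := by
    rw [ENNReal.ofReal_div_of_pos (by norm_num)]; simp
  rw [h12]
  refine ENNReal.ofReal_le_ofReal ?_
  rw [div_le_iff₀ (by positivity)]
  linarith

/-- **Symmetrization**: a sample that is bad for some `S j` differs, with probability at least one
half, from an independent ghost sample by half the deviation. -/
lemma measure_sampleBad_le_two_mul {ι Z J : Type*} [Fintype ι] [MeasurableSpace Z]
    [Countable J] (μ : Measure Z) [IsProbabilityMeasure μ] {S : J → Set Z}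
    (hS : ∀ j, MeasurableSet (S j)) {u : ℝ} (hu : 0 < u) (hun : Fintype.card ι ≤ 2 * u ^ 2) :
    (Measure.pi fun _ : ι => μ) (sampleBad μ S (2 * u)) ≤
      2 * (Measure.pi fun _ : ι => μ.prod μ) (ghostBad S u) := by
  set ν := Measure.pi fun _ : ι => μ with hν
  have hmp := measurePreserving_arrowProdEquivProdArrow Z Z ι (fun _ => μ) (fun _ => μ)
  set B : Set ((ι → Z) × (ι → Z)) := {q | ∃ j, u ≤ |hits (S j) q.1 - hits (S j) q.2|} with hB
  have hBm : MeasurableSet B := by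
    have : B = ⋃ j, {q | u ≤ |hits (S j) q.1 - hits (S j) q.2|} := by
      ext; simp [hB]
    rw [this]
    refine MeasurableSet.iUnion fun j => measurableSet_le measurable_const ?_
    exact continuous_abs.measurable.comp
      (((measurable_hits (hS j)).comp measurable_fst).sub
        ((measurable_hits (hS j)).comp measurable_snd))
  have hpre : (Measure.pi fun _ : ι => μ.prod μ) (ghostBad S u) = (ν.prod ν) B := by
    rw [← hmp.measure_preimage hBm.nullMeasurableSet]
    rfl
  have hbad : MeasurableSet (sampleBad μ S (2 * u) : Set (ι → Z)) :=
    measurableSet_sampleBad μ hS _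
  have hhalf : ∀ x ∈ (sampleBad μ S (2 * u) : Set (ι → Z)), 1 / 2 ≤ ν (Prod.mk x ⁻¹' B) := by
    rintro x ⟨j, hj⟩
    have h1 := measure_hits_dev_le_half (ι := ι) μ (hS j) hu hun
    have h2 : (Prod.mk x ⁻¹' B)ᶜ ⊆
        {y | u ≤ |hits (S j) y - Fintype.card ι * μ.real (S j)|} := by
      intro y hy
      have h3 : |hits (S j) x - hits (S j) y| < u := by
        by_contra hcon
        exact hy ⟨j, not_lt.1 hcon⟩
      have h4 := abs_sub_le (hits (S j) x) (hits (S j) y) (Fintype.card ι * μ.real (S j))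
      change u ≤ _
      linarith
    have h5 : ν (Prod.mk x ⁻¹' B)ᶜ ≤ 1 / 2 := (measure_mono h2).trans h1
    rw [prob_compl_eq_one_sub (measurable_prodMk_left hBm)] at h5
    rw [tsub_le_iff_right] at h5
    have h6 : (1 / 2 : ENNReal) + 1 / 2 ≤ 1 / 2 + ν (Prod.mk x ⁻¹' B) := by
      rw [ENNReal.add_halves]; exact h5
    exact (ENNReal.add_le_add_iff_left (by simp)).1 h6
  have hkey : 1 / 2 * ν (sampleBad μ S (2 * u)) ≤ (ν.prod ν) B := by
    rw [Measure.prod_apply hBm]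
    calc 1 / 2 * ν (sampleBad μ S (2 * u)) = ∫⁻ _ in sampleBad μ S (2 * u), 1 / 2 ∂ν := by simp
      _ ≤ ∫⁻ x in sampleBad μ S (2 * u), ν (Prod.mk x ⁻¹' B) ∂ν :=
          setLIntegral_mono' hbad hhalf
      _ ≤ ∫⁻ x, ν (Prod.mk x ⁻¹' B) ∂ν := setLIntegral_le_lintegral _ _
  rw [hpre]
  calc ν (sampleBad μ S (2 * u)) = 2 * (1 / 2 * ν (sampleBad μ S (2 * u))) := by
        rw [← mul_assoc, one_div, ENNReal.mul_inv_cancel (by simp) (by simp), one_mul]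
    _ ≤ _ := by gcongr

/-- The **Vapnik–Chervonenkis inequality**. -/
theorem measure_sampleBad_le {ι Z J : Type*} [Fintype ι] [Nonempty ι] [MeasurableSpace Z]
    [Countable J] (μ : Measure Z) [IsProbabilityMeasure μ] {S : J → Set Z} {G : Set Z} {d : ℕ}
    (hS : ∀ j, MeasurableSet (S j)) (hG : ∀ᵐ z ∂μ, z ∈ G) (h : VCDimLE S G d)
    (hd : d ≤ 2 * Fintype.card ι) {u : ℝ} (hu : 0 < u) (hun : Fintype.card ι ≤ 2 * u ^ 2) :
    (Measure.pi fun _ : ι => μ) (sampleBad μ S (2 * u)) ≤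
      ENNReal.ofReal (4 * Real.exp (d * Real.log (Real.exp 1 * (2 * Fintype.card ι) / d)
        - u ^ 2 / (2 * Fintype.card ι))) := by
  refine (measure_sampleBad_le_two_mul μ hS hu hun).trans ?_
  have h2 : (2 : ENNReal) = ENNReal.ofReal 2 := by simp
  calc 2 * (Measure.pi fun _ : ι => μ.prod μ) (ghostBad S u)
      ≤ 2 * ENNReal.ofReal ((∑ k ∈ Finset.range (d + 1), (2 * Fintype.card ι).choose k : ℕ) *
          (2 * Real.exp (-u ^ 2 / (2 * Fintype.card ι)))) := by
        gcongr
        exact measure_ghostBad_le μ hS hG h hu.le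
    _ = ENNReal.ofReal (2 * ((∑ k ∈ Finset.range (d + 1), (2 * Fintype.card ι).choose k : ℕ) *
          (2 * Real.exp (-u ^ 2 / (2 * Fintype.card ι))))) := by
        rw [ENNReal.ofReal_mul (by norm_num : (0 : ℝ) ≤ 2), ← h2]
    _ ≤ _ := by
        refine ENNReal.ofReal_le_ofReal ?_
        have h3 := sum_choose_le_exp hd
        push_cast at h3 ⊢
        rw [sub_eq_add_neg, Real.exp_add, ← neg_div]
        have h4 := mul_le_mul_of_nonneg_right h3
          (Real.exp_pos (-u ^ 2 / (2 * Fintype.card ι))).le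
        linarith

/-! ### From level sets to functions -/

/-- Rounding `c` up to a multiple of `h` by counting the levels `0, h, …, (m - 1) h` below `c`. -/
lemma sum_levels_bounds {c h : ℝ} (hc : 0 ≤ c) (hh : 0 < h) (m : ℕ) :
    min c (m * h) ≤ ∑ j ∈ Finset.range m, (if j * h < c then h else 0) ∧
      ∑ j ∈ Finset.range m, (if j * h < c then h else 0) ≤ c + h ∧
      ∑ j ∈ Finset.range m, (if j * h < c then h else 0) ≤ m * h := by
  induction m with
  | zero => simp only [Finset.range_zero, Finset.sum_empty, Nat.cast_zero, zero_mul]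
            exact ⟨min_le_right _ _, by positivity, le_rfl⟩
  | succ m ih =>
    obtain ⟨h1, h2, h3⟩ := ih
    rw [Finset.sum_range_succ]
    push_cast
    split_ifs with hm
    · rw [min_eq_right hm.le] at h1
      exact ⟨(min_le_right _ _).trans (by linarith), by linarith, by linarith⟩
    · rw [min_eq_left (not_lt.1 hm)] at h1
      exact ⟨(min_le_left _ _).trans (by linarith), by linarith, by linarith⟩

/-- A uniform bound for the deviations of the level sets of `f` bounds the deviation of the mean
of `f`, up to the mesh `h` of the levels. -/
lemma abs_sum_sub_integral_le {ι Z : Type*} [Fintype ι] [MeasurableSpace Z] (μ : Measure Z)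
    [IsProbabilityMeasure μ] {f : Z → ℝ} (hf : Measurable f) {G : Set Z} (hG : ∀ᵐ z ∂μ, z ∈ G)
    {h v : ℝ} (hh : 0 < h) (m : ℕ) (h0 : ∀ z ∈ G, 0 ≤ f z) (hB : ∀ z ∈ G, f z ≤ m * h)
    {x : ι → Z} (hx : ∀ i, x i ∈ G)
    (hdev : ∀ j < m, |hits {z | j * h < f z} x - Fintype.card ι * μ.real {z | j * h < f z}| ≤ v) :
    |∑ i, f (x i) - Fintype.card ι * ∫ z, f z ∂μ| ≤ m * h * v + Fintype.card ι * h := by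
  set n : ℝ := (Fintype.card ι : ℝ) with hn
  have hn0 : 0 ≤ n := Nat.cast_nonneg _
  let s : ℝ → ℝ := fun c => ∑ j ∈ Finset.range m, (if j * h < c then h else 0)
  have hs : ∀ z ∈ G, f z ≤ s (f z) ∧ s (f z) ≤ f z + h := fun z hz => by
    obtain ⟨h1, h2, -⟩ := sum_levels_bounds (h0 z hz) hh m
    rw [min_eq_left (hB z hz)] at h1
    exact ⟨h1, h2⟩
  have hA : ∀ j : ℕ, MeasurableSet {z | j * h < f z} := fun j =>
    measurableSet_lt measurable_const hf
  have hsf : ∀ z, s (f z) = ∑ j ∈ Finset.range m,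
      h * {z | j * h < f z}.indicator (fun _ => (1 : ℝ)) z := fun z => by
    simp [s, Set.indicator_apply]
  have hindint : ∀ j : ℕ,
      Integrable (fun z => h * {z | j * h < f z}.indicator (fun _ => (1 : ℝ)) z) μ :=
    fun j => ((integrable_const 1).indicator (hA j)).const_mul h
  have hfint : Integrable f μ := by
    refine Integrable.of_bound hf.aestronglyMeasurable (m * h) ?_
    filter_upwards [hG] with z hz
    rw [Real.norm_of_nonneg (h0 z hz)]
    exact hB z hz
  have hsint : Integrable (fun z => s (f z)) μ := by
    simp_rw [hsf]
    exact integrable_finsetSum _ fun j _ => hindint j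
  have hsum : ∑ i, s (f (x i)) = h * ∑ j ∈ Finset.range m, hits {z | j * h < f z} x := by
    simp_rw [hsf, hits]
    rw [Finset.sum_comm, Finset.mul_sum]
    exact Finset.sum_congr rfl fun j _ => by rw [Finset.mul_sum]
  have hintegral : ∫ z, s (f z) ∂μ = h * ∑ j ∈ Finset.range m, μ.real {z | j * h < f z} := by
    simp_rw [hsf]
    rw [integral_finsetSum _ fun j _ => hindint j, Finset.mul_sum]
    refine Finset.sum_congr rfl fun j _ => ?_
    rw [integral_const_mul, integral_indicator_const _ (hA j)]
    simp
  have hdev' : |∑ i, s (f (x i)) - n * ∫ z, s (f z) ∂μ| ≤ m * h * v := by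
    have : ∑ i, s (f (x i)) - n * ∫ z, s (f z) ∂μ = h * ∑ j ∈ Finset.range m,
        (hits {z | j * h < f z} x - n * μ.real {z | j * h < f z}) := by
      rw [hsum, hintegral, Finset.sum_sub_distrib, ← Finset.mul_sum]
      ring
    rw [this, abs_mul, abs_of_pos hh]
    calc h * |∑ j ∈ Finset.range m, (hits {z | j * h < f z} x - n * μ.real {z | j * h < f z})|
        ≤ h * ∑ _j ∈ Finset.range m, v := by
          gcongr
          exact (Finset.abs_sum_le_sum_abs _ _).trans
            (Finset.sum_le_sum fun j hj => hdev j (Finset.mem_range.1 hj))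
      _ = m * h * v := by simp; ring
  have h1 : ∑ i, f (x i) ≤ ∑ i, s (f (x i)) := Finset.sum_le_sum fun i _ => (hs _ (hx i)).1
  have h2 : ∑ i, s (f (x i)) ≤ ∑ i, f (x i) + n * h := by
    calc ∑ i, s (f (x i)) ≤ ∑ i, (f (x i) + h) := Finset.sum_le_sum fun i _ => (hs _ (hx i)).2
      _ = _ := by rw [Finset.sum_add_distrib]; simp [hn]
  have h3 : ∫ z, f z ∂μ ≤ ∫ z, s (f z) ∂μ :=
    integral_mono_ae hfint hsint (hG.mono fun z hz => (hs z hz).1)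
  have h4 : ∫ z, s (f z) ∂μ ≤ ∫ z, f z ∂μ + h := by
    calc ∫ z, s (f z) ∂μ ≤ ∫ z, (f z + h) ∂μ :=
          integral_mono_ae hsint (hfint.add (integrable_const h)) (hG.mono fun z hz => (hs z hz).2)
      _ = _ := by rw [integral_add hfint (integrable_const h)]; simp
  have h5 := mul_le_mul_of_nonneg_left h3 hn0
  have h6 := mul_le_mul_of_nonneg_left h4 hn0
  rw [abs_le] at hdev' ⊢
  constructor <;> linarith [hdev'.1, hdev'.2]

/-- **Uniform law of large numbers** for a family of functions with values in `[0, m h]` whose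
level sets at each fixed level have Vapnik–Chervonenkis dimension at most `d`. Level sets at
different levels need not have bounded dimension jointly, hence the union bound over the `m` levels.
Separability of the parameter space makes the event measurable. -/
theorem exists_uniform_deviation {ι Z Θ : Type*} [Fintype ι] [Nonempty ι] [MeasurableSpace Z]
    [TopologicalSpace Θ] [TopologicalSpace.SeparableSpace Θ] [FirstCountableTopology Θ]
    (μ : Measure Z) [IsProbabilityMeasure μ] {f : Θ → Z → ℝ} (hf : ∀ θ, Measurable (f θ))
    {G : Set Z} (hGm : MeasurableSet G) (hG : ∀ᵐ z ∂μ, z ∈ G)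
    (hcont : ∀ z ∈ G, Continuous fun θ => f θ z)
    {h : ℝ} (hh : 0 < h) (m : ℕ) (h0 : ∀ θ, ∀ z ∈ G, 0 ≤ f θ z)
    (hB : ∀ θ, ∀ z ∈ G, f θ z ≤ m * h)
    {d : ℕ} (hVC : ∀ t : ℝ, VCDimLE (fun θ : Θ => {z | t < f θ z}) G d)
    (hd : d ≤ 2 * Fintype.card ι) {u : ℝ} (hu : 0 < u) (hun : Fintype.card ι ≤ 2 * u ^ 2) :
    ∃ U : Set (ι → Z), MeasurableSet U ∧
      ENNReal.ofReal (1 - m * (4 * Real.exp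
        (d * Real.log (Real.exp 1 * (2 * Fintype.card ι) / d) - u ^ 2 / (2 * Fintype.card ι))))
          ≤ (Measure.pi fun _ : ι => μ) U ∧
      ∀ x ∈ U, ∀ θ, |∑ i, f θ (x i) - Fintype.card ι * ∫ z, f θ z ∂μ| ≤
        m * h * (2 * u) + Fintype.card ι * h := by
  obtain ⟨D, hDc, hD⟩ := TopologicalSpace.exists_countable_dense Θ
  have := hDc.to_subtype
  let S : ℕ → D → Set Z := fun j θ => {z | j * h < f θ z}
  have hS : ∀ j θ, MeasurableSet (S j θ) := fun j θ => measurableSet_lt measurable_const (hf _)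
  have hVC' : ∀ j, VCDimLE (S j) G d := fun j k z hz hT => hVC (j * h) k z hz fun T => by
    obtain ⟨θ, hθ⟩ := hT T
    exact ⟨θ, hθ⟩
  set ν := Measure.pi fun _ : ι => μ with hν
  set b : ℝ := 4 * Real.exp
    (d * Real.log (Real.exp 1 * (2 * Fintype.card ι) / d) - u ^ 2 / (2 * Fintype.card ι)) with hb
  have hgood : ∀ᵐ x ∂ν, ∀ i, x i ∈ G := by
    rw [ae_all_iff]
    intro i
    exact (measurePreserving_eval (fun _ : ι => μ) i).quasiMeasurePreserving.ae hG
  have hGm' : MeasurableSet {x : ι → Z | ∀ i, x i ∈ G} := by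
    have : {x : ι → Z | ∀ i, x i ∈ G} = Set.univ.pi fun _ => G := by ext; simp
    rw [this]
    exact MeasurableSet.univ_pi fun _ => hGm
  set V : Set (ι → Z) := ⋃ j ∈ Finset.range m, sampleBad μ (S j) (2 * u) with hV
  have hbad : MeasurableSet V :=
    Finset.measurableSet_biUnion _ fun j _ => measurableSet_sampleBad (ι := ι) μ (hS j) (2 * u)
  have hVb : ν V ≤ ENNReal.ofReal (m * b) := by
    calc ν V ≤ ∑ j ∈ Finset.range m, ν (sampleBad μ (S j) (2 * u)) :=
          measure_biUnion_finset_le _ _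
      _ ≤ ∑ _j ∈ Finset.range m, ENNReal.ofReal b :=
          Finset.sum_le_sum fun j _ => measure_sampleBad_le μ (hS j) hG (hVC' j) hd hu hun
      _ = ENNReal.ofReal (m * b) := by
          rw [ENNReal.ofReal_mul (Nat.cast_nonneg m)]
          simp
  refine ⟨{x | ∀ i, x i ∈ G} ∩ Vᶜ, hGm'.inter hbad.compl, ?_, ?_⟩
  · have h1 : ν ({x | ∀ i, x i ∈ G} ∩ Vᶜ) = ν Vᶜ := by
      refine measure_congr ?_
      filter_upwards [hgood] with x hx
      exact propext ⟨fun h => h.2, fun h => ⟨hx, h⟩⟩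
    rw [h1, prob_compl_eq_one_sub hbad, ENNReal.ofReal_sub _ (by positivity), ENNReal.ofReal_one]
    exact tsub_le_tsub_left hVb _
  · rintro x ⟨hxG, hx⟩
    have hclosed : IsClosed {θ | |∑ i, f θ (x i) - Fintype.card ι * ∫ z, f θ z ∂μ|
        ≤ m * h * (2 * u) + Fintype.card ι * h} := by
      refine isClosed_le (continuous_abs.comp (Continuous.sub ?_ (continuous_const.mul ?_)))
        continuous_const
      · exact continuous_finsetSum _ fun i _ => hcont _ (hxG i)
      · refine continuous_of_dominated (bound := fun _ => m * h)
          (fun θ => (hf θ).aestronglyMeasurable) (fun θ => ?_) (integrable_const _)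
          (hG.mono hcont)
        filter_upwards [hG] with z hz
        rw [Real.norm_of_nonneg (h0 θ z hz)]
        exact hB θ z hz
    have hsub : D ⊆ {θ | |∑ i, f θ (x i) - Fintype.card ι * ∫ z, f θ z ∂μ|
        ≤ m * h * (2 * u) + Fintype.card ι * h} := by
      intro θ hθ
      refine abs_sum_sub_integral_le μ (hf θ) hG hh m (h0 θ) (hB θ) hxG fun j hj => ?_
      by_contra hcon
      exact hx (Set.mem_biUnion (Finset.mem_coe.2 (Finset.mem_range.2 hj))
        ⟨⟨θ, hθ⟩, (not_le.1 hcon).le⟩)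
    intro θ
    exact hclosed.closure_subset_iff.2 hsub (hD θ)

/-- The exponent of the Sauer–Shelah bound dominates its value at `d = 1` and grows by at most a
factor `2` when the sample is doubled. -/
lemma sauer_exponent_bounds {d : ℕ} {n : ℝ} (hd : 0 < d) (hdn : d ≤ n) :
    Real.log (Real.exp 1 * n) ≤ d * Real.log (Real.exp 1 * n / d) ∧
      d * Real.log (Real.exp 1 * (2 * n) / d) ≤ 2 * (d * Real.log (Real.exp 1 * n / d)) := by
  have hd' : (1 : ℝ) ≤ d := by exact_mod_cast hd
  have hn : 0 < n := by linarith
  have h0 : 0 ≤ Real.log (n / d) := Real.log_nonneg ((one_le_div (by linarith)).2 hdn)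
  have h1 : Real.log (Real.exp 1 * n / d) = 1 + Real.log (n / d) := by
    rw [mul_div_assoc, Real.log_mul (by positivity) (by positivity), Real.log_exp]
  have h2 : Real.log (Real.exp 1 * (2 * n) / d) = Real.log 2 + Real.log (Real.exp 1 * n / d) := by
    rw [← Real.log_mul (by norm_num) (by positivity)]
    congr 1
    ring
  have h3 : Real.log (Real.exp 1 * n) = 1 + Real.log (n / d) + Real.log d := by
    rw [← h1, ← Real.log_mul (by positivity) (by positivity)]
    congr 1
    field_simp
  have h4 := Real.log_le_sub_one_of_pos (show (0 : ℝ) < d by linarith)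
  have h5 := Real.log_two_lt_d9
  rw [h2, h1, h3]
  constructor <;> nlinarith

/-- `exists_uniform_deviation` with the levels and the deviation chosen such that the sample size
condition makes the failure probability at most `δ`. Half of the tolerance `η / 2` is spent on the
mesh of the levels; the union bound over the levels costs a factor of order `B / η`, which the
sample size condition bounds by `n`, so that it is absorbed into `d log (e n / d)` as `d ≥ 1`. -/
theorem exists_uniform_deviation_of_le {ι Z Θ : Type*} [Fintype ι] [Nonempty ι]
    [MeasurableSpace Z]
    [TopologicalSpace Θ] [TopologicalSpace.SeparableSpace Θ] [FirstCountableTopology Θ]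
    (μ : Measure Z) [IsProbabilityMeasure μ] {f : Θ → Z → ℝ} (hf : ∀ θ, Measurable (f θ))
    {G : Set Z} (hGm : MeasurableSet G) (hG : ∀ᵐ z ∂μ, z ∈ G)
    (hcont : ∀ z ∈ G, Continuous fun θ => f θ z)
    {B : ℝ} (hB0 : 0 < B) (h0 : ∀ θ, ∀ z ∈ G, 0 ≤ f θ z) (hB : ∀ θ, ∀ z ∈ G, f θ z ≤ B)
    {d : ℕ} (hVC : ∀ t : ℝ, VCDimLE (fun θ : Θ => {z | t < f θ z}) G d) (hd0 : 0 < d)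
    (hd : d ≤ Fintype.card ι) {η δ : ℝ} (hη : 0 < η) (hδ0 : 0 < δ) (hδ1 : δ < 1)
    (hn : 512 * (B ^ 2 / η ^ 2 * (d * Real.log (Real.exp 1 * Fintype.card ι / d)
      + Real.log (2 / δ))) ≤ Fintype.card ι) :
    ∃ U : Set (ι → Z), MeasurableSet U ∧
      ENNReal.ofReal (1 - δ) ≤ (Measure.pi fun _ : ι => μ) U ∧
      ∀ x ∈ U, ∀ θ, |1 / (Fintype.card ι : ℝ) * ∑ i, f θ (x i) - ∫ z, f θ z ∂μ| ≤ η / 2 := by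
  set n : ℝ := (Fintype.card ι : ℝ) with hndef
  have hn1 : 1 ≤ n := Nat.one_le_cast.2 Fintype.card_pos
  have hn0 : 0 < n := by linarith
  have hlog2 := Real.log_two_gt_d9
  have hlogδ : Real.log 2 ≤ Real.log (2 / δ) := by
    refine Real.log_le_log (by norm_num) ?_
    rw [le_div_iff₀ hδ0]
    linarith
  obtain ⟨ha1, ha2⟩ := sauer_exponent_bounds hd0 (n := n) (Nat.cast_le.2 hd)
  set a : ℝ := d * Real.log (Real.exp 1 * n / d) with ha
  have hen : 1 ≤ Real.log (Real.exp 1 * n) := by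
    rw [Real.log_mul (by positivity) (by positivity), Real.log_exp]
    linarith [Real.log_nonneg hn1]
  have hmain : 512 * (a + Real.log (2 / δ)) ≤ n * η ^ 2 / B ^ 2 := by
    rw [le_div_iff₀ (by positivity)]
    have : 512 * (B ^ 2 / η ^ 2 * (a + Real.log (2 / δ))) * η ^ 2
        = 512 * (a + Real.log (2 / δ)) * B ^ 2 := by
      field_simp
    rw [← this]
    exact mul_le_mul_of_nonneg_right hn (by positivity)
  -- levels of mesh at most `η / 4`
  obtain ⟨m, hm⟩ : ∃ m : ℕ, m = ⌈4 * B / η⌉₊ := ⟨_, rfl⟩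
  have hm0 : (0 : ℝ) < m := by
    rw [hm]
    exact Nat.cast_pos.2 (Nat.ceil_pos.2 (by positivity))
  have hm1 : 4 * B / η ≤ m := hm ▸ Nat.le_ceil _
  have hmn : (m : ℝ) ≤ Real.exp 1 * n := by
    have h1 : (m : ℝ) < 4 * B / η + 1 := by
      rw [hm]
      exact Nat.ceil_lt_add_one (by positivity)
    have h2 : 4 * B / η ≤ n := by
      have h3 : 512 ≤ n * η ^ 2 / B ^ 2 := by linarith
      rw [le_div_iff₀ (by positivity)] at h3
      rw [div_le_iff₀ hη]
      refine le_of_sq_le_sq ?_ (by positivity)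
      have h4 : n * η ^ 2 ≤ (n * η) ^ 2 := by
        rw [mul_pow]
        exact mul_le_mul_of_nonneg_right (by nlinarith) (by positivity)
      nlinarith [sq_nonneg B]
    have h5 := Real.exp_one_gt_d9
    nlinarith
  set h : ℝ := B / m with hh
  have hh0 : 0 < h := by positivity
  have hmh : m * h = B := by rw [hh]; field_simp
  have hh4 : h ≤ η / 4 := by
    rw [hh, div_le_iff₀ hm0]
    rw [div_le_iff₀ hη] at hm1
    linarith
  -- deviations of the frequencies by `2 * u / n` change the means by at most `η / 4`
  set u : ℝ := n * η / (8 * B) with hu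
  have hu0 : 0 < u := by positivity
  have hu2 : u ^ 2 = n * (n * η ^ 2 / B ^ 2) / 64 := by
    rw [hu]; field_simp; norm_num
  have hun : n ≤ 2 * u ^ 2 := by
    rw [hu2]
    nlinarith
  obtain ⟨U, hUm, hUp, hU⟩ := exists_uniform_deviation μ hf hGm hG hcont hh0 m h0
    (by rwa [hmh]) hVC (hd.trans (by omega)) hu0 hun
  refine ⟨U, hUm, le_trans (ENNReal.ofReal_le_ofReal ?_) hUp, fun x hx θ => ?_⟩
  · have h4 : d * Real.log (Real.exp 1 * (2 * n) / d) - u ^ 2 / (2 * n) ≤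
        Real.log (δ / (4 * m)) := by
      have h5 : u ^ 2 / (2 * n) = (n * η ^ 2 / B ^ 2) / 128 := by
        rw [hu2]; field_simp; norm_num
      have h6 : Real.log (δ / (4 * m)) = - (Real.log (2 / δ) + Real.log 2 + Real.log m) := by
        rw [← Real.log_mul (by positivity) (by norm_num),
          ← Real.log_mul (by positivity) hm0.ne', ← Real.log_inv]
        congr 1
        field_simp
        norm_num
      have h7 := Real.log_le_log hm0 hmn
      rw [h5, h6]
      linarith
    have h7 := Real.exp_le_exp.2 h4
    rw [Real.exp_log (by positivity), le_div_iff₀ (by positivity)] at h7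
    linarith
  · have h8 := hU x hx θ
    have h9 : 1 / n * ∑ i, f θ (x i) - ∫ z, f θ z ∂μ =
        (∑ i, f θ (x i) - n * ∫ z, f θ z ∂μ) / n := by
      field_simp
    rw [h9, abs_div, abs_of_pos hn0, div_le_iff₀ hn0]
    have h10 : m * h * (2 * u) = n * (η / 4) := by
      rw [hmh, hu]
      field_simp
      norm_num
    have h11 := mul_le_mul_of_nonneg_left hh4 hn0.le
    linarith

/-! ### The pseudo-dimension of the loss class -/

/-- A class of functions in the span of finitely many functions `φ m` pseudo-shatters only
boundedly many points: a linear relation between the vectors `(φ (z i), t i)` forbids that the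
differences `f (z i) - t i` have the signs of its coefficients. -/
lemma PseudoShatters.le_card_add_one {Z κ : Type*} [Fintype κ] {F : Set (Z → ℝ)} (φ : κ → Z → ℝ)
    (hF : ∀ f ∈ F, ∃ c : κ → ℝ, ∀ z, f z = ∑ m, c m * φ m z) {k : ℕ} {z : Fin k → Z}
    {t : Fin k → ℝ} (h : PseudoShatters F z t) : k ≤ Fintype.card κ + 1 := by
  classical
  by_contra! hk
  let v : Fin k → (Option κ → ℝ) := fun i o => o.elim (t i) fun m => φ m (z i)
  have hdep : ¬ LinearIndependent ℝ v := by
    intro hv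
    have := hv.fintype_card_le_finrank
    simp at this
    omega
  obtain ⟨c, hc, i₀, hi₀⟩ := Fintype.not_linearIndependent_iff.1 hdep
  have hpos : ∀ c : Fin k → ℝ, ∑ i, c i • v i = 0 → ∀ i, c i ≤ 0 := by
    intro c hc i
    obtain ⟨f, hfF, hf⟩ := h {i | 0 < c i}
    obtain ⟨w, hw⟩ := hF f hfF
    have hco : ∀ o, ∑ i, c i * v i o = 0 := fun o => by
      have := congrFun hc o
      simpa using this
    have hzero : ∑ i, c i * (f (z i) - t i) = 0 := by
      have h1 : ∑ i, c i * f (z i) = 0 := by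
        simp_rw [hw, Finset.mul_sum]
        rw [Finset.sum_comm]
        refine Finset.sum_eq_zero fun m _ => ?_
        have h2 := hco (some m)
        simp only [v, Option.elim] at h2
        calc ∑ i, c i * (w m * φ m (z i)) = w m * ∑ i, c i * φ m (z i) := by
              rw [Finset.mul_sum]
              exact Finset.sum_congr rfl fun i _ => by ring
          _ = 0 := by rw [h2, mul_zero]
      have h3 : ∑ i, c i * t i = 0 := hco none
      simp_rw [mul_sub]
      rw [Finset.sum_sub_distrib, h1, h3, sub_zero]
    have hnn : ∀ i ∈ Finset.univ, 0 ≤ c i * (f (z i) - t i) := by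
      intro i _
      by_cases hci : 0 < c i
      · have := (hf i).2 hci
        exact mul_nonneg hci.le (by linarith)
      · have := mt (hf i).1 hci
        exact mul_nonneg_of_nonpos_of_nonpos (not_lt.1 hci) (by linarith)
    by_contra! hci
    have h4 := (Finset.sum_eq_zero_iff_of_nonneg hnn).1 hzero i (Finset.mem_univ i)
    have h5 := (hf i).2 hci
    rcases mul_eq_zero.1 h4 with h6 | h6 <;> linarith
  have h1 := hpos c hc i₀
  have h2 := hpos (fun i => -c i) (by simpa using hc) i₀
  exact hi₀ (by linarith)

/-- The squared loss of a predictor is a quadratic polynomial in the coefficient tensor, so that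
the loss class lies in a finite-dimensional space. -/
lemma pdim_lossClass_ttClass_ne_top {N : ℕ} (p χ : ℕ) (x₀ : Fin N → ℝ) (r Λ Ymax : ℝ) :
    pdim (lossClass x₀ r Ymax (ttClass p χ x₀ r Λ)) ≠ ⊤ := by
  let ψ : Option (Fin N → Fin (p + 1)) → patch x₀ r × Set.Icc (-Ymax) Ymax → ℝ := fun o z =>
    o.elim (z.2 : ℝ) fun α => featureMap (fun i => ((z.1 : Fin N → ℝ) i - x₀ i) / r) α
  let φ : Option (Fin N → Fin (p + 1)) × Option (Fin N → Fin (p + 1)) →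
    patch x₀ r × Set.Icc (-Ymax) Ymax → ℝ := fun m z => ψ m.1 z * ψ m.2 z
  have hF : ∀ f ∈ lossClass x₀ r Ymax (ttClass p χ x₀ r Λ),
      ∃ c : Option (Fin N → Fin (p + 1)) × Option (Fin N → Fin (p + 1)) → ℝ,
        ∀ z, f z = ∑ m, c m * φ m z := by
    rintro _ ⟨_, ⟨A, -, rfl⟩, rfl⟩
    let b : Option (Fin N → Fin (p + 1)) → ℝ := fun o => o.elim (-1) A
    refine ⟨fun m => b m.1 * b m.2, fun z => ?_⟩
    have h1 : predictor x₀ r A z.1 - z.2 = ∑ o, b o * ψ o z := by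
      rw [Fintype.sum_option]
      simp only [b, ψ, Option.elim, predictor, frobInner]
      ring
    dsimp only
    rw [h1, sq, Finset.sum_mul_sum, Fintype.sum_prod_type]
    refine Finset.sum_congr rfl fun o _ => Finset.sum_congr rfl fun o' _ => ?_
    simp only [φ]
    ring
  have hle : pdim (lossClass x₀ r Ymax (ttClass p χ x₀ r Λ)) ≤ ((Fintype.card
      (Option (Fin N → Fin (p + 1)) × Option (Fin N → Fin (p + 1))) + 1 : ℕ) : ℕ∞) := by
    refine iSup₂_le fun k hk => ?_
    obtain ⟨z, t, h⟩ := hk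
    exact Nat.cast_le.2 (h.le_card_add_one φ hF)
  exact ne_top_of_le_ne_top (ENat.natCast_ne_top _) hle

/-- Shattering by the level sets at one fixed level is pseudo-shattering with constant
thresholds. -/
lemma vcDimLE_of_pdim_le {N : ℕ} {p χ : ℕ} {x₀ : Fin N → ℝ} {r Λ Ymax : ℝ} {d : ℕ}
    (h : pdim (lossClass x₀ r Ymax (ttClass p χ x₀ r Λ)) ≤ d) (t : ℝ) :
    VCDimLE (fun A : ttTensors N p χ Λ => {z : (Fin N → ℝ) × ℝ |
      t < (predictor x₀ r (A : Tensor N p) z.1 - z.2) ^ 2})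
      (patch x₀ r ×ˢ Set.Icc (-Ymax) Ymax) d := by
  intro k z hz hT
  refine Nat.cast_le.1 (le_trans ?_ h)
  refine le_iSup₂ (f := fun (k : ℕ) _ => (k : ℕ∞)) k
    ⟨fun i => (⟨(z i).1, (hz i).1⟩, ⟨(z i).2, (hz i).2⟩), fun _ => t, fun T => ?_⟩
  obtain ⟨A, hA⟩ := hT T
  exact ⟨_, ⟨_, ⟨A, A.2, rfl⟩, rfl⟩, hA⟩

/-- A class of pseudo-dimension zero has at most one element. -/
lemma eq_of_pdim_eq_zero {Z : Type*} {F : Set (Z → ℝ)} (h : pdim F = 0) {f g : Z → ℝ}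
    (hf : f ∈ F) (hg : g ∈ F) : f = g := by
  have key : ∀ f ∈ F, ∀ g ∈ F, ∀ z, f z ≤ g z := by
    intro f hf g hg z
    by_contra! hlt
    have hs : PseudoShatters F (fun _ : Fin 1 => z) (fun _ => g z) := by
      intro S
      by_cases h0 : (0 : Fin 1) ∈ S
      · refine ⟨f, hf, fun i => ?_⟩
        rw [Subsingleton.elim i 0]
        exact iff_of_true hlt h0
      · refine ⟨g, hg, fun i => ?_⟩
        rw [Subsingleton.elim i 0]
        exact iff_of_false (lt_irrefl _) h0
    have h1 : ((1 : ℕ) : ℕ∞) ≤ pdim F :=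
      le_iSup₂ (f := fun (k : ℕ) _ => (k : ℕ∞)) 1 ⟨_, _, hs⟩
    rw [h] at h1
    simp at h1
  exact funext fun z => le_antisymm (key f hf g hg z) (key g hg f hf z)

/-! ### Bounds for the predictors -/

lemma sum_sq_pow_div_factorial_le {ξ : ℝ} (hξ : |ξ| ≤ 1) (p : ℕ) :
    ∑ a : Fin (p + 1), (ξ ^ (a : ℕ) / (Nat.factorial (a : ℕ) : ℝ)) ^ 2 ≤ besselK ^ 2 := by
  have hnn : ∀ k : ℕ, 0 ≤ 1 / (Nat.factorial k : ℝ) ^ 2 := fun k => by positivity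
  have hsum : Summable fun k : ℕ => 1 / (Nat.factorial k : ℝ) ^ 2 := by
    refine Summable.of_nonneg_of_le hnn (fun k => ?_) (Real.summable_pow_div_factorial 1)
    have : (1 : ℝ) ≤ Nat.factorial k := by exact_mod_cast Nat.factorial_pos k
    rw [one_pow]
    exact one_div_le_one_div_of_le (by positivity) (by nlinarith)
  rw [besselK, Real.sq_sqrt (tsum_nonneg hnn),
    Fin.sum_univ_eq_sum_range (fun k => (ξ ^ k / (Nat.factorial k : ℝ)) ^ 2) (p + 1)]
  refine (Finset.sum_le_sum fun k _ => ?_).trans (hsum.sum_le_tsum _ fun k _ => hnn k)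
  rw [div_pow]
  gcongr
  rw [← sq_abs, abs_pow, ← pow_mul]
  exact pow_le_one₀ (abs_nonneg _) hξ

/-- The squared Frobenius norm of the feature tensor factorizes over the modes. -/
lemma sum_sq_featureMap_le {N p : ℕ} {ξ : Fin N → ℝ} (hξ : ∀ i, |ξ i| ≤ 1) :
    ∑ α, featureMap (p := p) ξ α ^ 2 ≤ (besselK ^ N) ^ 2 := by
  have h : ∑ α, featureMap (p := p) ξ α ^ 2 =
      ∏ i, ∑ a : Fin (p + 1), (ξ i ^ (a : ℕ) / (Nat.factorial (a : ℕ) : ℝ)) ^ 2 := by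
    rw [Fintype.prod_sum]
    exact Finset.sum_congr rfl fun α _ => by rw [featureMap, Finset.prod_pow]
  rw [h, ← pow_mul, mul_comm, pow_mul]
  refine (Finset.prod_le_prod (fun i _ => Finset.sum_nonneg fun a _ => sq_nonneg _)
    fun i _ => sum_sq_pow_div_factorial_le (hξ i) p).trans_eq ?_
  simp

lemma besselK_pos : 0 < besselK := by
  have h := sum_sq_pow_div_factorial_le (ξ := 0) (by simp) 0
  have h0 : 0 ≤ besselK := Real.sqrt_nonneg _
  have h1 : 1 ≤ besselK ^ 2 := by simpa using h
  refine lt_of_le_of_ne h0 fun h2 => ?_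
  rw [← h2] at h1
  norm_num at h1

lemma abs_predictor_le {N p χ : ℕ} {x₀ : Fin N → ℝ} {r Λ : ℝ} (hr : 0 < r) {A : Tensor N p}
    (hA : A ∈ ttTensors N p χ Λ) {x : Fin N → ℝ} (hx : x ∈ patch x₀ r) :
    |predictor x₀ r A x| ≤ Λ * besselK ^ N := by
  have hΛ : 0 ≤ Λ := (Real.sqrt_nonneg _).trans hA.2
  have hK := besselK_pos
  have h1 : ∑ α, A α ^ 2 ≤ Λ ^ 2 := (Real.sqrt_le_left hΛ).1 hA.2
  have hξ : ∀ i, |(x i - x₀ i) / r| ≤ 1 := fun i => by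
    rw [abs_div, abs_of_pos hr, div_le_one hr]
    exact (norm_le_pi_norm (x - x₀) i).trans hx
  have h2 := sum_sq_featureMap_le (p := p) hξ
  refine abs_le_of_sq_le_sq ?_ (by positivity)
  calc predictor x₀ r A x ^ 2
      ≤ (∑ α, A α ^ 2) * ∑ α, featureMap (fun i => (x i - x₀ i) / r) α ^ 2 :=
        Finset.sum_mul_sq_le_sq_mul_sq _ _ _
    _ ≤ Λ ^ 2 * (besselK ^ N) ^ 2 := by gcongr
    _ = _ := by ring

lemma continuous_predictor {N p : ℕ} (x₀ : Fin N → ℝ) (r : ℝ) (A : Tensor N p) :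
    Continuous (predictor x₀ r A) := by
  unfold predictor frobInner featureMap
  fun_prop

lemma continuous_predictor_tensor {N p : ℕ} (x₀ : Fin N → ℝ) (r : ℝ) (x : Fin N → ℝ) :
    Continuous fun A : Tensor N p => predictor x₀ r A x := by
  unfold predictor frobInner
  fun_prop

/-! ### The noisy risk and the clean risk -/

/-- Noise that is centred given `X` is orthogonal to every bounded function of `X`, so that it adds
a constant to the quadratic risk. -/
lemma integral_sub_noise_sq {Ω E : Type*} [MeasurableSpace Ω] [mE : MeasurableSpace E]
    (P : Measure Ω) [IsProbabilityMeasure P] {X : Ω → E} (hX : Measurable X) {f : E → ℝ}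
    (hf : Measurable f) {M : ℝ} (hfM : ∀ᵐ ω ∂P, |f (X ω)| ≤ M) {e : Ω → ℝ} (he : Measurable e)
    {σ : ℝ} (heσ : ∀ᵐ ω ∂P, |e ω| ≤ σ) (hun : P[e | MeasurableSpace.comap X mE] =ᵐ[P] 0) :
    ∫ ω, (f (X ω) - e ω) ^ 2 ∂P = ∫ ω, f (X ω) ^ 2 ∂P + ∫ ω, e ω ^ 2 ∂P := by
  have hfX : MemLp (fun ω => f (X ω)) 2 P :=
    MemLp.of_bound (hf.comp hX).aestronglyMeasurable M hfM
  have heL : MemLp e 2 P := MemLp.of_bound he.aestronglyMeasurable σ heσ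
  have hprod : Integrable (fun ω => f (X ω) * e ω) P := hfX.integrable_mul heL
  have hle : MeasurableSpace.comap X mE ≤ ‹MeasurableSpace Ω› := hX.comap_le
  have hcross : ∫ ω, f (X ω) * e ω ∂P = 0 := by
    have hsm : StronglyMeasurable[MeasurableSpace.comap X mE] fun ω => f (X ω) :=
      (hf.comp (comap_measurable X)).stronglyMeasurable
    have h1 := condExp_mul_of_stronglyMeasurable_left hsm hprod (heL.integrable (by norm_num))
    rw [← integral_condExp hle]
    refine integral_eq_zero_of_ae (h1.trans ?_)
    filter_upwards [hun] with ω hω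
    simp [hω]
  have h2 : ∀ ω, (f (X ω) - e ω) ^ 2 = f (X ω) ^ 2 - 2 * (f (X ω) * e ω) + e ω ^ 2 :=
    fun ω => by ring
  simp_rw [h2]
  have i1 := hfX.integrable_sq
  have i2 := heL.integrable_sq
  have i3 : Integrable (fun ω => f (X ω) ^ 2 - 2 * (f (X ω) * e ω)) P :=
    i1.sub (hprod.const_mul 2)
  rw [integral_add i3 i2, integral_sub i1 (hprod.const_mul 2),
    integral_const_mul, hcross]
  ring

lemma isClosed_patch {N : ℕ} (x₀ : Fin N → ℝ) (r : ℝ) : IsClosed (patch x₀ r) :=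
  isClosed_le (by fun_prop) continuous_const

namespace LocalRegressionModel

variable {Ω : Type*} [MeasurableSpace Ω] {P : Measure Ω} {N n : ℕ} {x₀ : Fin N → ℝ} {r : ℝ}
  {PX : Measure (Fin N → ℝ)} {g : (Fin N → ℝ) → ℝ} {Gmax σ : ℝ} {X : Fin n → Ω → Fin N → ℝ}
  {Y ε : Fin n → Ω → ℝ}

lemma ae_mem_patch (hM : LocalRegressionModel P x₀ r PX g Gmax σ X Y ε) (i : Fin n) :
    ∀ᵐ ω ∂P, X i ω ∈ patch x₀ r := by
  have h := hM.supported
  rw [← hM.law_X i] at h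
  exact ae_of_ae_map (hM.measurable_X i).aemeasurable h

lemma ae_mem_data (hM : LocalRegressionModel P x₀ r PX g Gmax σ X Y ε) (i : Fin n) :
    ∀ᵐ z ∂P.map (fun ω => (X i ω, Y i ω)),
      z ∈ patch x₀ r ×ˢ Set.Icc (-(Gmax + σ)) (Gmax + σ) := by
  have hG : MeasurableSet (patch x₀ r ×ˢ Set.Icc (-(Gmax + σ)) (Gmax + σ)) :=
    (isClosed_patch x₀ r).measurableSet.prod measurableSet_Icc
  refine (ae_map_iff (p := (· ∈ patch x₀ r ×ˢ Set.Icc (-(Gmax + σ)) (Gmax + σ)))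
    ((hM.measurable_X i).prodMk (hM.measurable_Y i)).aemeasurable hG).2 ?_
  filter_upwards [hM.ae_mem_patch i, hM.label i, hM.bounded_noise i] with ω h1 h2 h3
  refine ⟨h1, abs_le.1 ?_⟩
  change |Y i ω| ≤ _
  rw [h2]
  exact (abs_add_le _ _).trans (add_le_add (hM.bounded_g _ h1) h3)

/-- The risk with respect to the noisy labels exceeds the clean risk by the variance of the
noise. -/
lemma integral_loss_eq [IsProbabilityMeasure P]
    (hM : LocalRegressionModel P x₀ r PX g Gmax σ X Y ε) (i : Fin n) {h : (Fin N → ℝ) → ℝ}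
    (hh : Measurable h) {M : ℝ} (hb : ∀ x ∈ patch x₀ r, |h x| ≤ M) :
    ∫ z, (h z.1 - z.2) ^ 2 ∂P.map (fun ω => (X i ω, Y i ω)) =
      cleanRisk PX g h + ∫ ω, ε i ω ^ 2 ∂P := by
  -- `g` is measurable on the patch only; its extension by zero is measurable
  let G : (Fin N → ℝ) → ℝ := Function.extend Subtype.val (fun x : patch x₀ r => g x) 0
  have hG : Measurable G :=
    (MeasurableEmbedding.subtype_coe (isClosed_patch x₀ r).measurableSet).measurable_extend
      hM.measurable_g measurable_zero
  have hGg : ∀ x ∈ patch x₀ r, G x = g x := fun x hx =>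
    Subtype.val_injective.extend_apply (fun x : patch x₀ r => g x) 0 ⟨x, hx⟩
  have hfb : ∀ᵐ ω ∂P, |h (X i ω) - G (X i ω)| ≤ M + Gmax := by
    filter_upwards [hM.ae_mem_patch i] with ω hω
    rw [hGg _ hω]
    exact (abs_sub _ _).trans (add_le_add (hb _ hω) (hM.bounded_g _ hω))
  have h1 := integral_sub_noise_sq P (hM.measurable_X i) (hh.sub hG) hfb (hM.measurable_noise i)
    (hM.bounded_noise i) (hM.unbiased i)
  have h2 : cleanRisk PX g h = ∫ ω, (h (X i ω) - G (X i ω)) ^ 2 ∂P := by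
    rw [cleanRisk, ← hM.law_X i, ← integral_map (f := fun x => (h x - G x) ^ 2)
      (hM.measurable_X i).aemeasurable ((hh.sub hG).pow_const 2).aestronglyMeasurable]
    refine integral_congr_ae ?_
    have h := hM.supported
    rw [← hM.law_X i] at h
    filter_upwards [h] with x hx
    rw [hGg x hx]
  have hm : Measurable fun z : (Fin N → ℝ) × ℝ => (h z.1 - z.2) ^ 2 :=
    ((hh.comp measurable_fst).sub measurable_snd).pow_const 2
  rw [integral_map ((hM.measurable_X i).prodMk (hM.measurable_Y i)).aemeasurable
    hm.aestronglyMeasurable, h2]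
  refine Eq.trans (integral_congr_ae ?_) h1
  filter_upwards [hM.label i, hM.ae_mem_patch i] with ω h3 h4
  simp only [Pi.sub_apply]
  rw [h3, hGg _ h4]
  ring

/-- The law of the sample is a product measure. -/
lemma map_sample [IsProbabilityMeasure P]
    (hM : LocalRegressionModel P x₀ r PX g Gmax σ X Y ε) (i₀ : Fin n) :
    P.map (fun ω i => (X i ω, Y i ω)) =
      Measure.pi fun _ : Fin n => P.map (fun ω => (X i₀ ω, Y i₀ ω)) := by
  have h := (iIndepFun_iff_map_fun_eq_pi_map fun i =>
    ((hM.measurable_X i).prodMk (hM.measurable_Y i)).aemeasurable).1 hM.indep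
  rw [h]
  congr 1
  funext i
  exact (hM.ident i i₀).map_eq

end LocalRegressionModel

/-- Uniform closeness of the empirical and the noisy risk makes every empirical risk minimizer
nearly optimal for the clean risk: the variance `c` of the noise cancels. -/
lemma cleanRisk_le_iInf_add_of_isERM {N n : ℕ} {H : Set ((Fin N → ℝ) → ℝ)}
    {PX : Measure (Fin N → ℝ)} {g : (Fin N → ℝ) → ℝ} {x : Fin n → Fin N → ℝ} {y : Fin n → ℝ}
    {c η : ℝ} (hdev : ∀ h ∈ H, |empRisk x y h - (cleanRisk PX g h + c)| ≤ η / 2)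
    {h : (Fin N → ℝ) → ℝ} (hh : IsERM H x y h) :
    cleanRisk PX g h ≤ (⨅ h' : H, cleanRisk PX g h') + η := by
  have : Nonempty H := ⟨⟨h, hh.1⟩⟩
  rw [← sub_le_iff_le_add]
  refine le_ciInf fun h' => ?_
  have h1 := abs_le.1 (hdev h hh.1)
  have h2 := abs_le.1 (hdev h' h'.2)
  have h3 := hh.2 h' h'.2
  linarith [h1.1, h2.2]

end LTTS

theorem mainTheorem8 :
    ∃ C : ℝ, 0 < C ∧
      ∀ (N p χ n : ℕ) (x₀ : Fin N → ℝ) (r Λ Gmax σ η δ : ℝ),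
        1 ≤ N → 1 ≤ χ → 1 ≤ n → 0 < r → 0 < Λ → 0 < η → 0 < δ → δ < 1 →
        ∀ {Ω : Type*} [MeasurableSpace Ω] (P : Measure Ω) [IsProbabilityMeasure P]
          (PX : Measure (Fin N → ℝ)) [IsProbabilityMeasure PX] (g : (Fin N → ℝ) → ℝ)
          (X : Fin n → Ω → Fin N → ℝ) (Y ε : Fin n → Ω → ℝ),
          LTTS.LocalRegressionModel P x₀ r PX g Gmax σ X Y ε →
          ∃ d : ℕ,
            LTTS.pdim (LTTS.lossClass x₀ r (Gmax + σ) (LTTS.ttClass p χ x₀ r Λ)) = (d : ℕ∞) ∧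
            (d ≤ n →
              C * ((Λ * LTTS.besselK ^ N + (Gmax + σ)) ^ 4 / η ^ 2 *
                (d * Real.log (Real.exp 1 * n / d) + Real.log (2 / δ))) ≤ n →
              ∃ E : Set Ω, MeasurableSet E ∧ ENNReal.ofReal (1 - δ) ≤ P E ∧
                ∀ ω ∈ E, ∀ h : (Fin N → ℝ) → ℝ,
                  LTTS.IsERM (LTTS.ttClass p χ x₀ r Λ) (fun i => X i ω) (fun i => Y i ω) h →
                  LTTS.cleanRisk PX g h ≤
                    (⨅ h' : LTTS.ttClass p χ x₀ r Λ, LTTS.cleanRisk PX g h') + η) := by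
  open LTTS in
  refine ⟨512, by norm_num, ?_⟩
  intro N p χ n x₀ r Λ Gmax σ η δ _ _ hn1 hr hΛ hη hδ0 hδ1 Ω _ P _ PX _ g X Y ε hM
  obtain ⟨d, hd⟩ := ENat.ne_top_iff_exists.1
    (pdim_lossClass_ttClass_ne_top p χ x₀ r Λ (Gmax + σ))
  refine ⟨d, hd.symm, fun hdn hsize => ?_⟩
  let i₀ : Fin n := ⟨0, hn1⟩
  have : Nonempty (Fin n) := ⟨i₀⟩
  have hZ : ∀ i, Measurable fun ω => (X i ω, Y i ω) := fun i =>
    (hM.measurable_X i).prodMk (hM.measurable_Y i)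
  set μ := P.map (fun ω => (X i₀ ω, Y i₀ ω)) with hμ
  have hμp : IsProbabilityMeasure μ := Measure.isProbabilityMeasure_map (hZ i₀).aemeasurable
  set c : ℝ := ∫ ω, ε i₀ ω ^ 2 ∂P with hc
  have hrisk : ∀ A ∈ ttTensors N p χ Λ, ∫ z, (predictor x₀ r A z.1 - z.2) ^ 2 ∂μ =
      cleanRisk PX g (predictor x₀ r A) + c := fun A hA =>
    hM.integral_loss_eq i₀ (continuous_predictor x₀ r A).measurable
      fun x hx => abs_predictor_le hr hA hx
  rcases Nat.eq_zero_or_pos d with rfl | hd0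
  · -- all losses coincide, hence so do all risks
    refine ⟨Set.univ, MeasurableSet.univ, ?_, fun ω _ h hh => ?_⟩
    · rw [measure_univ, ← ENNReal.ofReal_one]
      exact ENNReal.ofReal_le_ofReal (by linarith)
    · have : Nonempty (ttClass p χ x₀ r Λ) := ⟨⟨h, hh.1⟩⟩
      rw [← sub_le_iff_le_add]
      refine le_ciInf fun h' => ?_
      obtain ⟨A, hA, hAh⟩ := hh.1
      obtain ⟨A', hA', hAh'⟩ := h'.2
      have heq := eq_of_pdim_eq_zero hd.symm ⟨_, ⟨A, hA, rfl⟩, rfl⟩ ⟨_, ⟨A', hA', rfl⟩, rfl⟩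
      have hint : ∫ z, (predictor x₀ r A z.1 - z.2) ^ 2 ∂μ =
          ∫ z, (predictor x₀ r A' z.1 - z.2) ^ 2 ∂μ := by
        refine integral_congr_ae ?_
        filter_upwards [hM.ae_mem_data i₀] with z hz
        exact congrFun heq (⟨z.1, hz.1⟩, ⟨z.2, hz.2⟩)
      rw [hrisk A hA, hrisk A' hA', hAh, hAh'] at hint
      linarith
  set B : ℝ := (Λ * besselK ^ N + (Gmax + σ)) ^ 2 with hB
  have hY : 0 ≤ Gmax + σ := by
    obtain ⟨z, hz⟩ := (hM.ae_mem_data i₀).exists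
    linarith [hz.2.1, hz.2.2]
  have hK := besselK_pos
  have hB0 : 0 < B := by positivity
  have hloss : ∀ A : ttTensors N p χ Λ, ∀ z ∈ patch x₀ r ×ˢ Set.Icc (-(Gmax + σ)) (Gmax + σ),
      (predictor x₀ r (A : Tensor N p) z.1 - z.2) ^ 2 ≤ B := fun A z hz => by
    have h1 := abs_predictor_le hr A.2 hz.1
    have h2 : |z.2| ≤ Gmax + σ := abs_le.2 hz.2
    rw [hB, ← sq_abs]
    exact pow_le_pow_left₀ (abs_nonneg _) ((abs_sub _ _).trans (add_le_add h1 h2)) 2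
  obtain ⟨U, hUm, hUp, hU⟩ := exists_uniform_deviation_of_le (ι := Fin n) (Θ := ttTensors N p χ Λ)
    μ (f := fun A z => (predictor x₀ r (A : Tensor N p) z.1 - z.2) ^ 2)
    (fun A => (((continuous_predictor x₀ r (A : Tensor N p)).measurable.comp
      measurable_fst).sub measurable_snd).pow_const 2)
    ((isClosed_patch x₀ r).measurableSet.prod measurableSet_Icc) (hM.ae_mem_data i₀)
    (fun z _ => (((continuous_predictor_tensor x₀ r z.1).comp continuous_subtype_val).sub
      continuous_const).pow 2)
    hB0 (fun A z _ => sq_nonneg _) hloss (fun t => vcDimLE_of_pdim_le hd.symm.le t) hd0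
    (by simpa using hdn) hη hδ0 hδ1
    (by
      have h4 : B ^ 2 = (Λ * besselK ^ N + (Gmax + σ)) ^ 4 := by rw [hB]; ring
      rw [Fintype.card_fin, h4]
      exact hsize)
  have hZm : Measurable fun ω i => (X i ω, Y i ω) := measurable_pi_lambda _ hZ
  refine ⟨(fun ω i => (X i ω, Y i ω)) ⁻¹' U, hZm hUm, ?_, fun ω hω h hh => ?_⟩
  · rwa [← Measure.map_apply hZm hUm, hM.map_sample i₀]
  · refine cleanRisk_le_iInf_add_of_isERM (c := c) ?_ hh
    rintro _ ⟨A, hA, rfl⟩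
    have h1 := hU _ hω ⟨A, hA⟩
    rw [Fintype.card_fin, hrisk A hA] at h1
    exact h1
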